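/- **Conventions.** $N$ is a finite-dimensional smooth Hausdorff manifold without boundary. For an $\mathbb{R}^k$-valued one-form $\boldsymbol\eta=\sum_{\beta=1}^k\eta_\beta\otimes e_\beta$, kernels, contractions and $\mathrm{d}\boldsymbol\eta$ are taken componentwise. - $\boldsymbol\eta\in\Omega^1(N,\mathbb{R}^k)$ is a *$k$-contact form* if $\ker\boldsymbol\eta$ is a non-zero distribution of constant corank $k$, $\ker\mathrm{d}\boldsymbol\eta$ is a distribution of constant rank $k$, and $\ker\boldsymbol\eta\cap\ker\mathrm{d}\boldsymbol\eta=0$. - A smooth vector field $Y$ is *$\boldsymbol\eta$-Hamiltonian* if it is a Lie symmetry of $\ker\boldsymbol\eta$, i.e. $[Y,Z]$ takes values in $\ker\boldsymbol\eta$ for every smooth vector field $Z$ with values in $\ker\boldsymbol\eta$; its *$\boldsymbol\eta$-Hamiltonian $k$-function* is $-\iota_Y\boldsymbol\eta$. - A $t$-dependent vector field is a family $X=\{X_t\}_{t\in\mathbb{R}}$ of smooth vector fields. $V^X$ denotes the smallest real Lie algebra of smooth vector fields containing all the $X_t$. $X$ is a *Lie system* if all the $X_t$ lie in some finite-dimensional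 real Lie algebra of smooth vector fields (a Vessiot–Guldberg Lie algebra), i.e. $X_t=\sum_{\alpha=1}^r b_\alpha(t)X_\alpha$ with $X_1,\dots,X_r$ a basis of such a Lie algebra. - $(N,\boldsymbol\eta,X)$ is a *$k$-contact Lie system* if $\boldsymbol\eta$ is a $k$-contact form on $N$ and $X$ is a Lie system such that every element of $V^X$ is $\boldsymbol\eta$-Hamiltonian. - For $\ell\ge 0$ and $a=0,\dots,\ell$ let $\mathrm{pr}_a:N^{\ell+1}\to N$, $(x_{(0)},\dots,x_{(\ell)})\mapsto x_{(a)}$. The *diagonal prolongation* of a vector field $Y$ on $N$ is the vector field $Y^{[\ell+1]}(x_{(0)},\dots,x_{(\ell)})=(Y(x_{(0)}),\dots,Y(x_{(\ell)}))$ on $N^{\ell+1}$; for a $t$-dependent vector field, $(X^{[\ell+1]})_t=(X_t)^{[\ell+1]}$. **Proposition.** Let $(N,\boldsymbol\eta,X)$ be a $k$-contact Lie system and $\ell\ge 0$. Put $$\boldsymbol\eta_{N^{\ell+1}}=\sum_{a=0}^{\ell}\sum_{\beta=1}^{k}(\mathrm{pr}_a^*\eta_\beta)\otimes e_{ak+\beta}\in\Omega^1(N^{\ell+1},\mathbb{R}^{k(\ell+1)}).$$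 Then: 1. $\boldsymbol\eta_{N^{\ell+1}}$ is a $k(\ell+1)$-contact form on $N^{\ell+1}$. 2. If $Y$ is an $\boldsymbol\eta$-Hamiltonian vector field on $N$ with $\boldsymbol\eta$-Hamiltonian $k$-function $\boldsymbol h=\sum_\beta h_\beta e_\beta$, then $Y^{[\ell+1]}$ is an $\boldsymbol\eta_{N^{\ell+1}}$-Hamiltonian vector field, and its $\boldsymbol\eta_{N^{\ell+1}}$-Hamiltonian $k(\ell+1)$-function is $\sum_{a=0}^{\ell}\sum_{\beta=1}^{k}(\mathrm{pr}_a^*h_\beta)\,e_{ak+\beta}$. 3. $(N^{\ell+1},\boldsymbol\eta_{N^{\ell+1}},X^{[\ell+1]})$ is a $k(\ell+1)$-contact Lie system. If moreover $(t,x)\mapsto X_t(x)$ is smooth on $\mathbb{R}\times N$, then $X^{[\ell+1]}$ is smooth on $\mathbb{R}\times N^{\ell+1}$. -/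

import Mathlib

open scoped Manifold ContDiff Topology

noncomputable section

namespace KContact

/-! ### Vector fields and one-forms -/

section Basic

variable {E : Type*} [NormedAddCommGroup E] [NormedSpace ℝ E] {H : Type*} [TopologicalSpace H]
  (I : ModelWithCorners ℝ E H) {M : Type*} [TopologicalSpace M] [ChartedSpace H M]

/-- A smooth vector field on `M`: a smooth section of the tangent bundle. -/
def IsSmoothVectorField [IsManifold I ∞ M] (X : ∀ x : M, TangentSpace I x) : Prop :=
  ContMDiff I I.tangent ∞ fun x => (⟨x, X x⟩ : TangentBundle I M)

/-- A smooth one-form on `M` with values in `F`: a smooth section of the vector bundle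
`Hom(TM, M × F)`. -/
def IsSmoothOneForm [IsManifold I ∞ M] {F : Type*} [NormedAddCommGroup F] [NormedSpace ℝ F]
    (η : ∀ x : M, TangentSpace I x →L[ℝ] F) : Prop :=
  ContMDiff I (I.prod 𝓘(ℝ, E →L[ℝ] F)) ∞ fun x =>
    Bundle.TotalSpace.mk' (E →L[ℝ] F)
      (E := fun x : M => TangentSpace I x →L[ℝ] Bundle.Trivial M F x) x (η x)

/-- The local expression of an `F`-valued one-form in the preferred chart at `x`: its pull-back to
the model space along the inverse of that chart. -/
def localForm {F : Type*} [NormedAddCommGroup F] [NormedSpace ℝ F]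
    (η : ∀ x : M, TangentSpace I x →L[ℝ] F) (x : M) (y : E) : E →L[ℝ] F :=
  (η ((extChartAt I x).symm y)).comp
    (mfderivWithin 𝓘(ℝ, E) I (extChartAt I x).symm (Set.range I) y)

/-- The exterior derivative of an `F`-valued one-form at `x`: the exterior derivative of its local
expression in the preferred chart at `x`, pulled back to `T_x M` along that chart. -/
def extDerivOneForm {F : Type*} [NormedAddCommGroup F] [NormedSpace ℝ F]
    (η : ∀ x : M, TangentSpace I x →L[ℝ] F) (x : M) : TangentSpace I x [⋀^Fin 2]→L[ℝ] F :=
  (extDerivWithin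
      (fun y : E => ContinuousAlternatingMap.ofSubsingleton ℝ E F (0 : Fin 1) (localForm I η x y))
      (Set.range I) (extChartAt I x x)).compContinuousLinearMap
    (mfderiv I 𝓘(ℝ, E) (extChartAt I x) x)

/-- The kernel at `x` of the exterior derivative of `η`: all `v ∈ T_x M` with `ι_v dη = 0`. -/
def kerExtDeriv {F : Type*} [NormedAddCommGroup F] [NormedSpace ℝ F]
    (η : ∀ x : M, TangentSpace I x →L[ℝ] F) (x : M) : Submodule ℝ (TangentSpace I x) where
  carrier := {v | ∀ w : TangentSpace I x, extDerivOneForm I η x ![v, w] = 0}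
  zero_mem' := fun w => (extDerivOneForm I η x).map_coord_zero (0 : Fin 2) rfl
  add_mem' := fun {a b} ha hb w => by
    have h := (extDerivOneForm I η x).toAlternatingMap.toMultilinearMap.cons_add ![w] a b
    exact h.trans ((congrArg₂ (· + ·) (ha w) (hb w)).trans (add_zero 0))
  smul_mem' := fun c a ha w => by
    have h := (extDerivOneForm I η x).toAlternatingMap.toMultilinearMap.cons_smul ![w] c a
    exact h.trans ((congrArg (c • ·) (ha w)).trans (smul_zero c))

/-! ### `k`-contact forms and Hamiltonian vector fields -/

/-- `η` is a `k`-contact form on `M`: a smooth `ℝ^k`-valued one-form such that `ker η` is a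
non-zero distribution of constant corank `k`, `ker dη` is a distribution of constant rank `k`, and
`ker η ∩ ker dη = 0`. -/
structure IsKContactForm [IsManifold I ∞ M] {k : ℕ}
    (η : ∀ x : M, TangentSpace I x →L[ℝ] (Fin k → ℝ)) : Prop where
  smooth : IsSmoothOneForm I η
  ker_ne_bot : ∀ x, LinearMap.ker (η x : TangentSpace I x →ₗ[ℝ] (Fin k → ℝ)) ≠ ⊥
  corank_ker : ∀ x,
    Module.finrank ℝ (TangentSpace I x ⧸
      LinearMap.ker (η x : TangentSpace I x →ₗ[ℝ] (Fin k → ℝ))) = k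
  rank_kerExtDeriv : ∀ x, Module.finrank ℝ (kerExtDeriv I η x) = k
  ker_inf_kerExtDeriv : ∀ x,
    LinearMap.ker (η x : TangentSpace I x →ₗ[ℝ] (Fin k → ℝ)) ⊓ kerExtDeriv I η x = ⊥

/-- `X` is an `η`-Hamiltonian vector field: a smooth vector field that is a Lie symmetry of the
distribution `ker η`, i.e. `[X, Y]` takes values in `ker η` whenever the smooth vector field `Y`
does. -/
def IsHamiltonianVectorField [IsManifold I ∞ M] {k : ℕ}
    (η : ∀ x : M, TangentSpace I x →L[ℝ] (Fin k → ℝ)) (X : ∀ x : M, TangentSpace I x) : Prop :=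
  IsSmoothVectorField I X ∧
    ∀ Y : (∀ x : M, TangentSpace I x), IsSmoothVectorField I Y → (∀ x, η x (Y x) = 0) →
      ∀ x, η x (VectorField.mlieBracket I X Y x) = 0

/-- The `η`-Hamiltonian `k`-function `-ι_X η` of an `η`-Hamiltonian vector field `X`. -/
def hamiltonianFunction {k : ℕ} (η : ∀ x : M, TangentSpace I x →L[ℝ] (Fin k → ℝ))
    (X : ∀ x : M, TangentSpace I x) (x : M) : Fin k → ℝ :=
  -η x (X x)

/-! ### Lie systems -/

/-- `V` is a real Lie algebra of smooth vector fields on `M`, with the Lie bracket of vector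
fields. -/
def IsLieAlgebraOfVectorFields [IsManifold I ∞ M]
    (V : Submodule ℝ (∀ x : M, TangentSpace I x)) : Prop :=
  (∀ Y ∈ V, IsSmoothVectorField I Y) ∧ ∀ Y ∈ V, ∀ Z ∈ V, VectorField.mlieBracket I Y Z ∈ V

/-- The smallest Lie algebra `V^X` of vector fields that contains all the vector fields `X_t` of a
`t`-dependent vector field `X`. -/
def smallestLieAlgebra [IsManifold I ∞ M] (X : ℝ → ∀ x : M, TangentSpace I x) :
    Submodule ℝ (∀ x : M, TangentSpace I x) :=
  sInf {V | IsLieAlgebraOfVectorFields I V ∧ ∀ t, X t ∈ V}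

/-- A `t`-dependent vector field `X` is a Lie system: it takes values in a finite-dimensional real
Lie algebra `V` of smooth vector fields (a Vessiot--Guldberg Lie algebra). In terms of a basis
`X_1, …, X_r` of `V`, this says `X_t = ∑ b_α(t) X_α` for some functions `b_α` of `t`. -/
def IsLieSystem [IsManifold I ∞ M] (X : ℝ → ∀ x : M, TangentSpace I x) : Prop :=
  ∃ V : Submodule ℝ (∀ x : M, TangentSpace I x),
    IsLieAlgebraOfVectorFields I V ∧ FiniteDimensional ℝ V ∧ ∀ t, X t ∈ V

/-- `(M, η, X)` is a `k`-contact Lie system. -/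
structure IsKContactLieSystem [IsManifold I ∞ M] {k : ℕ}
    (η : ∀ x : M, TangentSpace I x →L[ℝ] (Fin k → ℝ)) (X : ℝ → ∀ x : M, TangentSpace I x) :
    Prop where
  isKContactForm : IsKContactForm I η
  isLieSystem : IsLieSystem I X
  isHamiltonian : ∀ Y ∈ smallestLieAlgebra I X, IsHamiltonianVectorField I η Y

end Basic

/-! ### The manifold `N^{ℓ+1}` and diagonal prolongations -/

section Prolongation

variable {E : Type*} [NormedAddCommGroup E] [NormedSpace ℝ E] {H : Type*} [TopologicalSpace H]
  (I : ModelWithCorners ℝ E H) {N : Type*} [TopologicalSpace N] [ChartedSpace H N]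

/-- The model of the product manifold `N^{ℓ+1} = (Fin (ℓ + 1) → N)`. -/
abbrev powModel (ℓ : ℕ) :
    ModelWithCorners ℝ (Fin (ℓ + 1) → E) (ModelPi fun _ : Fin (ℓ + 1) => H) :=
  ModelWithCorners.pi fun _ : Fin (ℓ + 1) => I

/-- `N^{ℓ+1}`, with the product charts, is a manifold. -/
instance isManifold_pow (n : WithTop ℕ∞) [IsManifold I n N] (ℓ : ℕ) :
    IsManifold (powModel I ℓ) n (Fin (ℓ + 1) → N) := by
  refine isManifold_of_contDiffOn _ _ _ ?_
  rintro _ _ ⟨e, he, rfl⟩ ⟨e', he', rfl⟩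
  rw [contDiffOn_pi]
  intro i
  have h := (contDiffGroupoid n I).compatible (he i trivial) (he' i trivial)
  rw [contDiffGroupoid, mem_groupoid_of_pregroupoid] at h
  have h1 : ContDiffOn ℝ n (I ∘ ((e i).symm ≫ₕ e' i) ∘ I.symm)
    (I.symm ⁻¹' ((e i).symm ≫ₕ e' i).source ∩ Set.range I) := h.1
  refine h1.comp (contDiff_apply ℝ E i).contDiffOn ?_
  rintro y ⟨⟨hy1, hy2⟩, y0, rfl⟩
  exact ⟨⟨hy1 i trivial, hy2 i trivial⟩, y0 i, rfl⟩

/-- The diagonal prolongation to `N^{ℓ+1}` of a vector field `X` on `N`: its value at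
`(x_0, …, x_ℓ)` is `(X(x_0), …, X(x_ℓ))` in `T_{x_0} N × ⋯ × T_{x_ℓ} N = T_x N^{ℓ+1}`. -/
def diagonalProlongation (ℓ : ℕ) (X : ∀ x : N, TangentSpace I x) (x : Fin (ℓ + 1) → N) :
    TangentSpace (powModel I ℓ) x :=
  fun a : Fin (ℓ + 1) => (X (x a) : E)

/-- The prolongation `X^{[ℓ+1]}` projects to `X` under each of the projections `N^{ℓ+1} → N`. -/
theorem mfderiv_proj_diagonalProlongation (ℓ : ℕ) (X : ∀ x : N, TangentSpace I x)
    (a : Fin (ℓ + 1)) (x : Fin (ℓ + 1) → N) :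
    mfderiv (powModel I ℓ) I (fun y : Fin (ℓ + 1) → N => y a) x
      (diagonalProlongation I ℓ X x) = X (x a) := by
  have h : HasMFDerivAt (powModel I ℓ) I (fun y : Fin (ℓ + 1) → N => y a) x
      (ContinuousLinearMap.proj (R := ℝ) (φ := fun _ : Fin (ℓ + 1) => E) a) := by
    refine ⟨(continuous_apply a).continuousAt, ?_⟩
    have h' : HasFDerivWithinAt (fun y : Fin (ℓ + 1) → E => y a)
        (ContinuousLinearMap.proj (R := ℝ) (φ := fun _ : Fin (ℓ + 1) => E) a)
        (Set.range (powModel I ℓ)) (extChartAt (powModel I ℓ) x x) :=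
      (ContinuousLinearMap.proj (R := ℝ) (φ := fun _ : Fin (ℓ + 1) => E) a).hasFDerivWithinAt
    refine h'.congr_of_eventuallyEq ?_ ?_
    · filter_upwards [extChartAt_target_mem_nhdsWithin (I := powModel I ℓ) x] with y hy
      exact (extChartAt I (x a)).right_inv ⟨hy.1 a trivial, hy.2 a trivial⟩
    · exact (extChartAt I (x a)).right_inv
        ((extChartAt I (x a)).map_source (mem_extChartAt_source (x a)))
  rw [h.mfderiv]
  rfl

/-- The linear map `ℝ^k → ℝ^{k(ℓ+1)}` with `e_β ↦ e_{ak+β}`, for `a = 0, …, ℓ`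
(`finProdFinEquiv (a, β)` is the index `β + k * a`). -/
def blockInclusion (ℓ k : ℕ) (a : Fin (ℓ + 1)) : (Fin k → ℝ) →L[ℝ] (Fin ((ℓ + 1) * k) → ℝ) :=
  ∑ β : Fin k, (ContinuousLinearMap.proj (R := ℝ) (φ := fun _ : Fin k => ℝ) β).smulRight
    (Pi.single (finProdFinEquiv (a, β)) 1)

/-- The form `∑_a pr_a^* η = ∑_a ∑_β (pr_a^* η_β) ⊗ e_{ak+β}` on `N^{ℓ+1}`, where
`pr_a : N^{ℓ+1} → N` is the projection to the `a`-th factor. -/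
def prolongedForm (ℓ : ℕ) {k : ℕ} (η : ∀ x : N, TangentSpace I x →L[ℝ] (Fin k → ℝ))
    (x : Fin (ℓ + 1) → N) :
    TangentSpace (powModel I ℓ) x →L[ℝ] (Fin ((ℓ + 1) * k) → ℝ) :=
  ∑ a : Fin (ℓ + 1), (blockInclusion ℓ k a).comp
    ((η (x a)).comp (mfderiv (powModel I ℓ) I (fun y : Fin (ℓ + 1) → N => y a) x))

/-- The function `∑_a pr_a^* h = ∑_a ∑_β (pr_a^* h_β) e_{ak+β}` on `N^{ℓ+1}`. -/
def prolongedFunction (ℓ : ℕ) {k : ℕ} (h : N → Fin k → ℝ) (x : Fin (ℓ + 1) → N) :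
    Fin ((ℓ + 1) * k) → ℝ :=
  ∑ a : Fin (ℓ + 1), blockInclusion ℓ k a (h (x a))

end Prolongation

end KContact

end

/-!
The inverse charts of `N^{ℓ+1}` are products of inverse charts of `N`, so the local expression of
`prolongedForm` is a sum of blocks, the `a`-th of which depends only on the `a`-th coordinate. Hence
the kernels of the prolonged form and of its exterior derivative are the products of the kernels on
the factors, which gives the contact conditions.

Let `Z` be a vector field on `N^{ℓ+1}` annihilated by the prolonged form. The `a`-th component of
`[Y^{[ℓ+1]}, Z]` at `x` is the bracket of `Y` with the restriction of `Z_a` to the slice through `x`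
in the direction of the `a`-th factor, plus the derivative at `x` of `Z_a` along directions that fix
`x_a`. The slice field takes values in `ker η`, so the bracket does; along directions fixing `x_a`
the field `Z_a` stays in the fixed subspace `ker η (x_a)`, so its derivative does. Finally,
`Y ↦ Y^{[ℓ+1]}` is linear and preserves brackets, so it maps Lie algebras of vector fields to such.
-/

noncomputable section

namespace KContact

/-! ### Finite products of vector spaces -/

section PiSubmodule

theorem eq_bot_of_pi_univ_eq_bot {ι R : Type*} [Semiring R] {V : ι → Type*}
    [∀ i, AddCommMonoid (V i)] [∀ i, Module R (V i)] {p : ∀ i, Submodule R (V i)}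
    (hp : Submodule.pi Set.univ p = ⊥) (i : ι) : p i = ⊥ := by
  classical
  refine (Submodule.eq_bot_iff _).2 fun v hv => ?_
  have hsingle := Submodule.le_comap_single_pi (I := Set.univ) p hv
  rw [hp] at hsingle
  exact Pi.single_eq_zero_iff.1 hsingle

theorem finrank_submodule_pi {ι K : Type*} [Fintype ι] [DivisionRing K] {V : ι → Type*}
    [∀ i, AddCommGroup (V i)] [∀ i, Module K (V i)] (p : ∀ i, Submodule K (V i))
    [∀ i, Module.Finite K (p i)] :
    Module.finrank K (Submodule.pi Set.univ p) = ∑ i, Module.finrank K (p i) := by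
  have hrange : LinearMap.range (LinearMap.piMap fun i => (p i).subtype) =
      Submodule.pi Set.univ p := by
    ext v
    refine ⟨?_, fun hv => ⟨fun i => ⟨v i, hv i trivial⟩, rfl⟩⟩
    rintro ⟨w, rfl⟩ i -
    exact (w i).2
  have hinj : Function.Injective (LinearMap.piMap fun i => (p i).subtype) :=
    Function.Injective.piMap fun i => (p i).injective_subtype
  rw [← hrange, LinearMap.finrank_range_of_inj hinj, Module.finrank_pi_fintype]

theorem finrank_quotient_pi {ι K : Type*} [Fintype ι] [Field K] {V : ι → Type*}
    [∀ i, AddCommGroup (V i)] [∀ i, Module K (V i)] (p : ∀ i, Submodule K (V i))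
    [∀ i, Module.Finite K (V i ⧸ p i)] :
    Module.finrank K ((∀ i, V i) ⧸ Submodule.pi Set.univ p) =
      ∑ i, Module.finrank K (V i ⧸ p i) := by
  classical
  rw [(Submodule.quotientPi p).finrank_eq, Module.finrank_pi_fintype]

variable {R V W : Type*} [Ring R] [IsNoetherianRing R] [AddCommGroup V] [Module R V]
  [AddCommGroup W] [Module R W] [Module.Finite R W]

theorem finite_quotient_ker (f : V →ₗ[R] W) : Module.Finite R (V ⧸ LinearMap.ker f) :=
  Module.Finite.equiv f.quotKerEquivRange.symm

theorem finite_of_ker_inf_eq_bot (f : V →ₗ[R] W) {p : Submodule R V}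
    (hp : LinearMap.ker f ⊓ p = ⊥) : Module.Finite R p :=
  Module.Finite.of_injective (f.domRestrict p)
    (LinearMap.injective_domRestrict_iff.2 (disjoint_iff.2 hp).symm)

end PiSubmodule

/-! ### Derivatives and Lie brackets on a finite product of normed spaces -/

section PiCalculus

variable {𝕜 ι : Type*} [NontriviallyNormedField 𝕜] {E : ι → Type*}
  [∀ i, NormedAddCommGroup (E i)] [∀ i, NormedSpace 𝕜 (E i)] {F : Type*} [NormedAddCommGroup F]
  [NormedSpace 𝕜 F] {s : ∀ i, Set (E i)} {y : ∀ i, E i}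

theorem fderivWithin_piMap_apply [Finite ι] {f : ∀ i, E i → E i}
    (hs : ∀ i, UniqueDiffWithinAt 𝕜 (s i) (y i))
    (hf : ∀ i, DifferentiableWithinAt 𝕜 (f i) (s i) (y i)) (v : ∀ i, E i) (i : ι) :
    fderivWithin 𝕜 (Pi.map f) (Set.univ.pi s) y v i = fderivWithin 𝕜 (f i) (s i) (y i) (v i) := by
  have := Fintype.ofFinite ι
  have hcomp (j : ι) : HasFDerivWithinAt (fun z => f j (z j))
      ((fderivWithin 𝕜 (f j) (s j) (y j)).comp (ContinuousLinearMap.proj j))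
      (Set.univ.pi s) y :=
    (hf j).hasFDerivWithinAt.comp y (hasFDerivAt_apply j y).hasFDerivWithinAt
      fun z hz => hz j trivial
  exact congrFun (DFunLike.congr_fun ((hasFDerivWithinAt_pi.2 hcomp).fderivWithin
    (UniqueDiffWithinAt.univ_pi hs)) v) i

theorem lieBracketWithin_piMap [Fintype ι] {V W : ∀ i, E i → E i}
    (hs : ∀ i, UniqueDiffWithinAt 𝕜 (s i) (y i))
    (hV : ∀ i, DifferentiableWithinAt 𝕜 (V i) (s i) (y i))
    (hW : ∀ i, DifferentiableWithinAt 𝕜 (W i) (s i) (y i)) :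
    VectorField.lieBracketWithin 𝕜 (Pi.map V) (Pi.map W) (Set.univ.pi s) y =
      fun i => VectorField.lieBracketWithin 𝕜 (V i) (W i) (s i) (y i) := by
  funext i
  simp only [VectorField.lieBracketWithin_eq, Pi.sub_apply, fderivWithin_piMap_apply hs hV,
    fderivWithin_piMap_apply hs hW, Pi.map_apply]

theorem fderivWithin_comp_update [Finite ι] [DecidableEq ι] {W : (∀ i, E i) → F}
    (hy : y ∈ Set.univ.pi s)
    (hW : DifferentiableWithinAt 𝕜 W (Set.univ.pi s) y) {i : ι}
    (hs : UniqueDiffWithinAt 𝕜 (s i) (y i)) (v : E i) :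
    fderivWithin 𝕜 (fun z => W (Function.update y i z)) (s i) (y i) v =
      fderivWithin 𝕜 W (Set.univ.pi s) y (Pi.single i v) := by
  have := Fintype.ofFinite ι
  have hmaps : Set.MapsTo (Function.update y i) (s i) (Set.univ.pi s) := fun z hz =>
    (Set.update_mem_pi_iff_of_mem hy).2 fun _ => hz
  have hW' : HasFDerivWithinAt W (fderivWithin 𝕜 W (Set.univ.pi s) y) (Set.univ.pi s)
      (Function.update y i (y i)) := by
    simpa only [Function.update_eq_self] using hW.hasFDerivWithinAt
  have hcomp := hW'.comp (y i) (hasFDerivAt_update y (y i)).hasFDerivWithinAt hmaps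
  refine (DFunLike.congr_fun (hcomp.fderivWithin hs) v).trans (congrArg _ (funext fun j => ?_))
  rcases eq_or_ne j i with rfl | hj <;> simp [*]

theorem hasFDerivWithinAt_apply_eq_zero_of_slice [Finite ι] {g : (∀ i, E i) → F}
    {g' : (∀ i, E i) →L[𝕜] F}
    (hy : y ∈ Set.univ.pi s) (hs : ∀ i, UniqueDiffWithinAt 𝕜 (s i) (y i))
    (hg : HasFDerivWithinAt g g' (Set.univ.pi s) y) {i : ι}
    (hg0 : ∀ᶠ z in 𝓝[Set.univ.pi s] y, z i = y i → g z = 0) {v : ∀ i, E i} (hv : v i = 0) :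
    g' v = 0 := by
  classical
  have := Fintype.ofFinite ι
  have hmaps : Set.MapsTo (fun z => Function.update z i (y i)) (Set.univ.pi s) (Set.univ.pi s) :=
    fun z hz => (Set.update_mem_pi_iff_of_mem hz).2 fun _ => hy i trivial
  have hproj : HasFDerivWithinAt (fun z => Function.update z i (y i))
      (ContinuousLinearMap.pi (Function.update (ContinuousLinearMap.proj (R := 𝕜)) i 0))
      (Set.univ.pi s) y := by
    refine hasFDerivWithinAt_pi.2 fun j => ?_
    rcases eq_or_ne j i with rfl | hj
    · simpa only [Function.update_self] using hasFDerivWithinAt_const (y j) y (Set.univ.pi s)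
    · simpa only [Function.update_of_ne hj] using (hasFDerivAt_apply j y).hasFDerivWithinAt
  have hfix : Function.update y i (y i) = y := Function.update_eq_self i y
  have hcomp := HasFDerivWithinAt.comp (g := g) y (hfix.symm ▸ hg) hproj hmaps
  have htendsto : Filter.Tendsto (fun z => Function.update z i (y i)) (𝓝[Set.univ.pi s] y)
      (𝓝[Set.univ.pi s] y) := by
    simpa only [hfix] using hproj.continuousWithinAt.tendsto_nhdsWithin hmaps
  have hzero : g ∘ (fun z => Function.update z i (y i)) =ᶠ[𝓝[Set.univ.pi s] y] fun _ => 0 := by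
    filter_upwards [htendsto.eventually hg0] with z hz
    exact hz (Function.update_self ..)
  have hunique := (UniqueDiffWithinAt.univ_pi hs).eq hcomp
    ((hasFDerivWithinAt_const (0 : F) y _).congr_of_eventuallyEq hzero
      (hzero.self_of_nhdsWithin hy))
  refine (congrArg g' (funext fun j => ?_)).trans (DFunLike.congr_fun hunique v)
  rcases eq_or_ne j i with rfl | hj <;> simp [*]

theorem lieBracketWithin_piMap_left_apply [Fintype ι] [DecidableEq ι]
    {V : ∀ i, E i → E i} {W : (∀ i, E i) → ∀ i, E i}
    (hy : y ∈ Set.univ.pi s) (hs : ∀ i, UniqueDiffWithinAt 𝕜 (s i) (y i))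
    (hV : ∀ i, DifferentiableWithinAt 𝕜 (V i) (s i) (y i))
    (hW : DifferentiableWithinAt 𝕜 W (Set.univ.pi s) y) (i : ι) :
    VectorField.lieBracketWithin 𝕜 (Pi.map V) W (Set.univ.pi s) y i =
      VectorField.lieBracketWithin 𝕜 (V i) (fun z => W (Function.update y i z) i) (s i) (y i) +
        fderivWithin 𝕜 W (Set.univ.pi s) y (Function.update (Pi.map V y) i 0) i := by
  have hsplit : Pi.map V y = Pi.single i (V i (y i)) + Function.update (Pi.map V y) i 0 := by
    funext j
    rcases eq_or_ne j i with rfl | hj <;> simp [*]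
  have hslice : fderivWithin 𝕜 (fun z => W (Function.update y i z) i) (s i) (y i) (V i (y i)) =
      fderivWithin 𝕜 W (Set.univ.pi s) y (Pi.single i (V i (y i))) i := by
    rw [fderivWithin_comp_update (W := fun z => W z i) hy (differentiableWithinAt_pi.1 hW i) (hs i),
      fderivWithin_apply hW (UniqueDiffWithinAt.univ_pi hs) i]
    rfl
  simp only [VectorField.lieBracketWithin_eq, Pi.sub_apply, Function.update_eq_self,
    fderivWithin_piMap_apply hs hV, hslice]
  rw [hsplit, map_add, ← hsplit, Pi.add_apply, add_sub_right_comm]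

end PiCalculus

/-! ### Local expressions of vector fields and one-forms -/

section LocalField

variable {𝕜 : Type*} [NontriviallyNormedField 𝕜] {E : Type*} [NormedAddCommGroup E]
  [NormedSpace 𝕜 E] {H : Type*} [TopologicalSpace H]
  {I : ModelWithCorners 𝕜 E H} {M : Type*} [TopologicalSpace M] [ChartedSpace H M]
  {F : Type*} [NormedAddCommGroup F] [NormedSpace 𝕜 F]

theorem contMDiffAt_comp_extChartAt_iff {n : WithTop ℕ∞} {g : E → F} {x : M} :
    ContMDiffAt I 𝓘(𝕜, F) n (fun p => g (extChartAt I x p)) x ↔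
      ContDiffWithinAt 𝕜 n g (Set.range I) (extChartAt I x x) := by
  have hg : (fun y => g (extChartAt I x ((extChartAt I x).symm y)))
      =ᶠ[𝓝[Set.range I] extChartAt I x x] g := by
    filter_upwards [extChartAt_target_mem_nhdsWithin (I := I) x] with y hy
    rw [(extChartAt I x).right_inv hy]
  rw [contMDiffAt_iff]
  refine ⟨fun h => ?_, fun h => ⟨?_, ?_⟩⟩
  · exact h.2.congr_of_eventuallyEq hg.symm (hg.self_of_nhdsWithin (Set.mem_range_self _)).symm
  · exact h.continuousWithinAt.tendsto.comp
      (tendsto_nhdsWithin_iff.2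
        ⟨continuousAt_extChartAt x, .of_forall fun _ => Set.mem_range_self _⟩)
  · exact h.congr_of_eventuallyEq hg (hg.self_of_nhdsWithin (Set.mem_range_self _))

theorem trivializationAt_tangentSpace_snd [IsManifold I 1 M] {x p : M}
    (hp : p ∈ (chartAt H x).source) (v : TangentSpace I p) :
    (trivializationAt E (TangentSpace I) x (⟨p, v⟩ : TangentBundle I M)).2 =
      mfderiv I 𝓘(𝕜, E) (extChartAt I x) p v := by
  rw [← TangentBundle.continuousLinearMapAt_trivializationAt hp]
  exact (Bundle.Trivialization.continuousLinearMapAt_apply_of_mem 𝕜 _ hp v).symm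

variable (I) in
/-- The local expression of a vector field in the preferred chart at `x`: its push-forward to the
model space along that chart. It is only meaningful on the target of the chart. -/
def localField (V : ∀ x : M, TangentSpace I x) (x : M) (y : E) : E :=
  mfderiv I 𝓘(𝕜, E) (extChartAt I x) ((extChartAt I x).symm y) (V ((extChartAt I x).symm y))

theorem localField_extChartAt (V : ∀ x : M, TangentSpace I x) {x p : M}
    (hp : p ∈ (extChartAt I x).source) :
    localField I V x (extChartAt I x p) = mfderiv I 𝓘(𝕜, E) (extChartAt I x) p (V p) :=
  congrArg (fun q => (mfderiv I 𝓘(𝕜, E) (extChartAt I x) q (V q) : E))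
    ((extChartAt I x).left_inv hp)

theorem localField_extChartAt_self [IsManifold I 1 M] (V : ∀ x : M, TangentSpace I x) (x : M) :
    localField I V x (extChartAt I x x) = V x := by
  rw [localField_extChartAt V (mem_extChartAt_source x), mfderiv_extChartAt_self]
  rfl

theorem mlieBracket_eq_lieBracketWithin_localField [IsManifold I 1 M]
    (V W : ∀ x : M, TangentSpace I x) (x : M) :
    VectorField.mlieBracket I V W x = VectorField.lieBracketWithin 𝕜 (localField I V x)
      (localField I W x) (Set.range I) (extChartAt I x x) := by
  have hlocal (U : ∀ x : M, TangentSpace I x) :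
      VectorField.mpullbackWithin 𝓘(𝕜, E) I (extChartAt I x).symm U (Set.range I)
        =ᶠ[𝓝[Set.range I] extChartAt I x x] localField I U x := by
    filter_upwards [extChartAt_target_mem_nhdsWithin (I := I) x] with y hy
    rw [VectorField.mpullbackWithin_apply,
      ContinuousLinearMap.inverse_eq (mfderivWithin_extChartAt_symm_comp_mfderiv_extChartAt hy)
        (mfderiv_extChartAt_comp_mfderivWithin_extChartAt_symm hy)]
    rfl
  rw [← VectorField.mlieBracketWithin_univ, VectorField.mlieBracketWithin_apply,
    mfderiv_extChartAt_self, Set.preimage_univ, Set.univ_inter]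
  refine (DFunLike.congr_fun (ContinuousLinearMap.inverse_id (R := 𝕜) (M := E)) _).trans ?_
  exact (hlocal V).lieBracketWithin_vectorField_eq_of_mem (hlocal W) (Set.mem_range_self _)

end LocalField

section LocalForm

variable {E : Type*} [NormedAddCommGroup E] [NormedSpace ℝ E] {H : Type*} [TopologicalSpace H]
  {I : ModelWithCorners ℝ E H} {M : Type*} [TopologicalSpace M] [ChartedSpace H M]
  {F : Type*} [NormedAddCommGroup F] [NormedSpace ℝ F]

theorem localForm_extChartAt {η : ∀ x : M, TangentSpace I x →L[ℝ] F} {x p : M}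
    (hp : p ∈ (extChartAt I x).source) :
    localForm I η x (extChartAt I x p) = (η p : E →L[ℝ] F).comp
      (mfderivWithin 𝓘(ℝ, E) I (extChartAt I x).symm (Set.range I) (extChartAt I x p)) :=
  congrArg (fun q => (η q : E →L[ℝ] F).comp
    (mfderivWithin 𝓘(ℝ, E) I (extChartAt I x).symm (Set.range I) (extChartAt I x p)))
    ((extChartAt I x).left_inv hp)

theorem isSmoothVectorField_iff_localField [IsManifold I ∞ M] {V : ∀ x : M, TangentSpace I x} :
    IsSmoothVectorField I V ↔
      ∀ x, ContDiffWithinAt ℝ ∞ (localField I V x) (Set.range I) (extChartAt I x x) := by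
  have : IsManifold I 1 M := inferInstance
  refine forall_congr' fun x => ?_
  rw [← contMDiffAt_comp_extChartAt_iff, Bundle.contMDiffAt_section]
  refine Filter.EventuallyEq.contMDiffAt_iff ?_
  filter_upwards [chart_source_mem_nhds H x] with p hp
  rw [localField_extChartAt V (by rwa [extChartAt_source])]
  exact trivializationAt_tangentSpace_snd hp (V p)

theorem isSmoothOneForm_iff_localForm [IsManifold I ∞ M] {η : ∀ x : M, TangentSpace I x →L[ℝ] F} :
    IsSmoothOneForm I η ↔
      ∀ x, ContDiffWithinAt ℝ ∞ (localForm I η x) (Set.range I) (extChartAt I x x) := by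
  have : IsManifold I 1 M := inferInstance
  refine forall_congr' fun x => ?_
  rw [← contMDiffAt_comp_extChartAt_iff, contMDiffAt_hom_bundle]
  refine (and_iff_right contMDiffAt_id).trans (Filter.EventuallyEq.contMDiffAt_iff ?_)
  filter_upwards [chart_source_mem_nhds H x] with p hp
  rw [localForm_extChartAt (by rwa [extChartAt_source]),
    ← TangentBundle.symmL_trivializationAt (I := I) (𝕜 := ℝ) hp]
  ext v
  exact DFunLike.congr_fun (Bundle.Trivial.continuousLinearMapAt_trivialization ℝ M F p) _

theorem IsSmoothVectorField.differentiableWithinAt_localField [IsManifold I ∞ M]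
    {V : ∀ x : M, TangentSpace I x} (hV : IsSmoothVectorField I V) (x : M) :
    DifferentiableWithinAt ℝ (localField I V x) (Set.range I) (extChartAt I x x) :=
  (isSmoothVectorField_iff_localField.1 hV x).differentiableWithinAt (by simp)

theorem IsSmoothOneForm.differentiableWithinAt_localForm [IsManifold I ∞ M]
    {η : ∀ x : M, TangentSpace I x →L[ℝ] F} (hη : IsSmoothOneForm I η) (x : M) :
    DifferentiableWithinAt ℝ (localForm I η x) (Set.range I) (extChartAt I x x) :=
  (isSmoothOneForm_iff_localForm.1 hη x).differentiableWithinAt (by simp)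

theorem extDerivOneForm_apply [IsManifold I ∞ M] {η : ∀ x : M, TangentSpace I x →L[ℝ] F}
    (hη : IsSmoothOneForm I η) (x : M) (v w : E) :
    extDerivOneForm I η x ![v, w] =
      fderivWithin ℝ (localForm I η x) (Set.range I) (extChartAt I x x) v w -
        fderivWithin ℝ (localForm I η x) (Set.range I) (extChartAt I x x) w v := by
  have : IsManifold I 1 M := inferInstance
  have hs : UniqueDiffWithinAt ℝ (Set.range I) (extChartAt I x x) :=
    I.uniqueDiffOn _ (Set.mem_range_self _)
  have hd := hη.differentiableWithinAt_localForm x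
  have hω : DifferentiableWithinAt ℝ (fun y : E =>
      ContinuousAlternatingMap.ofSubsingleton ℝ E F (0 : Fin 1) (localForm I η x y))
      (Set.range I) (extChartAt I x x) :=
    (ContinuousAlternatingMap.ofSubsingletonLIE (𝕜 := ℝ) (E := E) (F := F)
      (0 : Fin 1)).toContinuousLinearEquiv.differentiableAt.comp_differentiableWithinAt _ hd
  have hflip (u : E) :
      fderivWithin ℝ (fun y => localForm I η x y u) (Set.range I) (extChartAt I x x) =
        (fderivWithin ℝ (localForm I η x) (Set.range I) (extChartAt I x x)).flip u := by
    rw [fderivWithin_clm_apply hs hd (differentiableWithinAt_const u)]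
    simp
  have hchart : extDerivOneForm I η x ![v, w] = extDerivWithin (fun y : E =>
      ContinuousAlternatingMap.ofSubsingleton ℝ E F (0 : Fin 1) (localForm I η x y))
      (Set.range I) (extChartAt I x x) ![v, w] := by
    rw [extDerivOneForm, mfderiv_extChartAt_self]
    rfl
  rw [hchart, extDerivWithin_apply hω hs]
  generalize extChartAt I x x = y₀ at hflip
  simp [Fin.sum_univ_two, hflip, Fin.removeNth, sub_eq_add_neg]

end LocalForm

/-! ### Finite products of manifolds -/

section PiManifold

variable {𝕜 : Type*} [NontriviallyNormedField 𝕜] {ι : Type*} [Fintype ι] {E : ι → Type*}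
  [∀ i, NormedAddCommGroup (E i)] [∀ i, NormedSpace 𝕜 (E i)] {H : ι → Type*}
  [∀ i, TopologicalSpace (H i)] {I : ∀ i, ModelWithCorners 𝕜 (E i) (H i)} {M : ι → Type*}
  [∀ i, TopologicalSpace (M i)] [∀ i, ChartedSpace (H i) (M i)]
  {E' : Type*} [NormedAddCommGroup E'] [NormedSpace 𝕜 E'] {H' : Type*} [TopologicalSpace H']
  {I' : ModelWithCorners 𝕜 E' H'} {M' : Type*} [TopologicalSpace M'] [ChartedSpace H' M']

theorem range_modelWithCorners_pi :
    Set.range (ModelWithCorners.pi I) = Set.univ.pi fun i => Set.range (I i) :=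
  Set.range_piMap _

theorem extChartAt_pi_target (x : ∀ i, M i) :
    (extChartAt (ModelWithCorners.pi I) x).target =
      Set.univ.pi fun i => (extChartAt (I i) (x i)).target := by
  ext y
  exact ⟨fun h i _ => ⟨h.1 i trivial, h.2 i trivial⟩,
    fun h => ⟨fun i _ => (h i trivial).1, fun i _ => (h i trivial).2⟩⟩

theorem contMDiffAt_piManifold {n : WithTop ℕ∞} {f : M' → ∀ i, M i} {m : M'} :
    ContMDiffAt I' (ModelWithCorners.pi I) n f m ↔
      ∀ i, ContMDiffAt I' (I i) n (fun q => f q i) m := by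
  simp only [contMDiffAt_iff, continuousAt_pi, forall_and]
  exact and_congr_right fun _ => contDiffWithinAt_pi

theorem hasMFDerivWithinAt_piManifold {f : M' → ∀ i, M i} {s : Set M'} {m : M'}
    {f' : TangentSpace I' m →L[𝕜] ∀ i, E i} :
    HasMFDerivWithinAt I' (ModelWithCorners.pi I) f s m f' ↔
      ∀ i, HasMFDerivWithinAt I' (I i) (fun q => f q i) s m
        ((ContinuousLinearMap.proj i).comp f') := by
  simp only [HasMFDerivWithinAt, continuousWithinAt_pi, forall_and]
  exact and_congr_right fun _ => hasFDerivWithinAt_pi'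

theorem contMDiff_proj {n : WithTop ℕ∞} (i : ι) :
    ContMDiff (ModelWithCorners.pi I) (I i) n (fun x : ∀ i, M i => x i) := fun _ =>
  contMDiffAt_piManifold.1 contMDiffAt_id i

theorem hasMFDerivAt_proj (i : ι) (x : ∀ i, M i) :
    HasMFDerivAt (ModelWithCorners.pi I) (I i) (fun x : ∀ i, M i => x i) x
      (ContinuousLinearMap.proj (R := 𝕜) (φ := E) i) :=
  (hasMFDerivWithinAt_piManifold.1 (hasMFDerivAt_id x).hasMFDerivWithinAt i).hasMFDerivAt
    Filter.univ_mem

theorem contMDiff_update [DecidableEq ι] {n : WithTop ℕ∞} (x : ∀ i, M i) (i : ι) :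
    ContMDiff (I i) (ModelWithCorners.pi I) n (Function.update x i) := fun p => by
  refine contMDiffAt_piManifold.2 fun j => ?_
  rcases eq_or_ne j i with rfl | h
  · simpa only [Function.update_self] using! contMDiffAt_id
  · simpa only [Function.update_of_ne h] using contMDiffAt_const

theorem mfderiv_extChartAt_pi [∀ i, IsManifold (I i) 1 (M i)] {x p : ∀ i, M i}
    (hp : p ∈ (extChartAt (ModelWithCorners.pi I) x).source) :
    mfderiv (ModelWithCorners.pi I) 𝓘(𝕜, ∀ i, E i) (extChartAt (ModelWithCorners.pi I) x) p =
      ContinuousLinearMap.piMap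
        fun i => (mfderiv (I i) 𝓘(𝕜, E i) (extChartAt (I i) (x i)) (p i) : E i →L[𝕜] E i) := by
  have h (i : ι) : HasMFDerivAt (ModelWithCorners.pi I) 𝓘(𝕜, E i)
      (fun q : ∀ i, M i => extChartAt (I i) (x i) (q i)) p
      ((mfderiv (I i) 𝓘(𝕜, E i) (extChartAt (I i) (x i)) (p i)).comp
        (ContinuousLinearMap.proj (R := 𝕜) (φ := E) i)) :=
    HasMFDerivAt.comp (I' := I i) p (mdifferentiableAt_extChartAt (hp.1 i trivial)).hasMFDerivAt
      (hasMFDerivAt_proj i p)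
  refine HasMFDerivAt.mfderiv ⟨continuousAt_pi.2 fun i => (h i).1, ?_⟩
  exact hasFDerivWithinAt_pi'.2 fun i => (h i).2

theorem mfderivWithin_extChartAt_symm_pi [∀ i, IsManifold (I i) 1 (M i)] {x : ∀ i, M i}
    {y : ∀ i, E i} (hy : y ∈ (extChartAt (ModelWithCorners.pi I) x).target) :
    mfderivWithin 𝓘(𝕜, ∀ i, E i) (ModelWithCorners.pi I)
        (extChartAt (ModelWithCorners.pi I) x).symm (Set.range (ModelWithCorners.pi I)) y =
      ContinuousLinearMap.piMap fun i => (mfderivWithin 𝓘(𝕜, E i) (I i)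
        (extChartAt (I i) (x i)).symm (Set.range (I i)) (y i) : E i →L[𝕜] E i) := by
  refine HasMFDerivWithinAt.mfderivWithin (hasMFDerivWithinAt_piManifold.2 fun i => ?_)
    ((ModelWithCorners.pi I).uniqueMDiffOn y (extChartAt_target_subset_range x hy))
  have hyi : y i ∈ (extChartAt (I i) (x i)).target :=
    (extChartAt_pi_target (I := I) x ▸ hy) i trivial
  refine HasMFDerivWithinAt.comp (I' := 𝓘(𝕜, E i)) (u := Set.range (I i)) y
    (mdifferentiableWithinAt_extChartAt_symm hyi).hasMFDerivWithinAt
    (ContinuousLinearMap.proj (R := 𝕜) (φ := E) i).hasMFDerivAt.hasMFDerivWithinAt ?_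
  rintro _ ⟨z, rfl⟩
  exact ⟨z i, rfl⟩

theorem contMDiffAt_tangentBundle_pi {n : WithTop ℕ∞} [∀ i, IsManifold (I i) 1 (M i)]
    [IsManifold (ModelWithCorners.pi I) 1 (∀ i, M i)]
    {f : M' → ∀ i, M i} {V : M' → ∀ i, E i} {m : M'} :
    ContMDiffAt I' (ModelWithCorners.pi I).tangent n
        (fun q => (⟨f q, V q⟩ : TangentBundle (ModelWithCorners.pi I) (∀ i, M i))) m ↔
      ∀ i, ContMDiffAt I' (I i).tangent n
        (fun q => (⟨f q i, V q i⟩ : TangentBundle (I i) (M i))) m := by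
  simp only [Bundle.contMDiffAt_totalSpace, forall_and]
  refine (and_congr_left' contMDiffAt_piManifold).trans (and_congr_right fun hf => ?_)
  have hbase : ContMDiffAt I' (ModelWithCorners.pi I) n f m := contMDiffAt_piManifold.2 hf
  refine contMDiffAt_pi_space.trans (forall_congr' fun i => Filter.EventuallyEq.contMDiffAt_iff ?_)
  filter_upwards [hbase.continuousAt (chart_source_mem_nhds (ModelPi H) (f m))] with q hq
  have hmfderiv := mfderiv_extChartAt_pi (I := I) (x := f m) (p := f q)
    (by rwa [extChartAt_source])
  refine (congrFun ((trivializationAt_tangentSpace_snd (I := ModelWithCorners.pi I) hq (V q)).trans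
    (DFunLike.congr_fun hmfderiv (V q))) i).trans ?_
  exact (trivializationAt_tangentSpace_snd (hq i trivial) (V q i)).symm

end PiManifold

/-! ### Prolongation of vector fields -/

section ProlongedField

variable {E : Type*} [NormedAddCommGroup E] [NormedSpace ℝ E] {H : Type*} [TopologicalSpace H]
  {I : ModelWithCorners ℝ E H} {N : Type*} [TopologicalSpace N] [ChartedSpace H N] {ℓ : ℕ}

/-- The `a`-th component of a vector field on `N^{ℓ+1}`, restricted to the slice through `x` in the
direction of the `a`-th factor, as a vector field on `N`. -/
def sliceField (Z : ∀ x : Fin (ℓ + 1) → N, TangentSpace (powModel I ℓ) x) (x : Fin (ℓ + 1) → N)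
    (a : Fin (ℓ + 1)) (p : N) : TangentSpace I p :=
  (Z (Function.update x a p) : Fin (ℓ + 1) → E) a

theorem IsSmoothVectorField.diagonalProlongation [IsManifold I ∞ N]
    {Y : ∀ x : N, TangentSpace I x} (hY : IsSmoothVectorField I Y) :
    IsSmoothVectorField (powModel I ℓ) (diagonalProlongation I ℓ Y) := by
  have : IsManifold I 1 N := inferInstance
  intro x
  refine contMDiffAt_tangentBundle_pi.2 fun a => ?_
  exact hY.comp (contMDiff_proj (I := fun _ : Fin (ℓ + 1) => I) a) x

theorem IsSmoothVectorField.sliceField [IsManifold I ∞ N]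
    {Z : ∀ x : Fin (ℓ + 1) → N, TangentSpace (powModel I ℓ) x}
    (hZ : IsSmoothVectorField (powModel I ℓ) Z) (x : Fin (ℓ + 1) → N) (a : Fin (ℓ + 1)) :
    IsSmoothVectorField I (sliceField Z x a) := by
  have : IsManifold I 1 N := inferInstance
  intro p
  have hslice := contMDiffAt_tangentBundle_pi.1 ((hZ.comp (contMDiff_update x a)) p) a
  refine hslice.congr_of_eventuallyEq (.of_forall fun q => ?_)
  exact congrArg (fun q' => (⟨q', KContact.sliceField Z x a q⟩ : TangentBundle I N))
    (Function.update_self a q x).symm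

theorem localField_pow_apply [IsManifold I 1 N]
    (Z : ∀ x : Fin (ℓ + 1) → N, TangentSpace (powModel I ℓ) x) {x : Fin (ℓ + 1) → N}
    {y : Fin (ℓ + 1) → E} (hy : y ∈ (extChartAt (powModel I ℓ) x).target) (a : Fin (ℓ + 1)) :
    localField (powModel I ℓ) Z x y a =
      mfderiv I 𝓘(ℝ, E) (extChartAt I (x a)) ((extChartAt I (x a)).symm (y a))
        ((Z ((extChartAt (powModel I ℓ) x).symm y) : Fin (ℓ + 1) → E) a) :=
  congrFun (DFunLike.congr_fun (mfderiv_extChartAt_pi ((extChartAt _ x).map_target hy)) _) a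

theorem localField_sliceField [IsManifold I 1 N]
    (Z : ∀ x : Fin (ℓ + 1) → N, TangentSpace (powModel I ℓ) x) (x : Fin (ℓ + 1) → N)
    {a : Fin (ℓ + 1)} {z : E} (hz : z ∈ (extChartAt I (x a)).target) :
    localField I (sliceField Z x a) (x a) z =
      localField (powModel I ℓ) Z x (Function.update (extChartAt (powModel I ℓ) x x) a z) a := by
  set y := Function.update (extChartAt (powModel I ℓ) x x) a z with hydef
  have hya : y a = z := Function.update_self ..
  have hy : y ∈ (extChartAt (powModel I ℓ) x).target := by
    rw [extChartAt_pi_target, Set.update_mem_pi_iff_of_mem]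
    · exact fun _ => hz
    · exact fun b _ => mem_extChartAt_target (x b)
  have hsymm : (extChartAt (powModel I ℓ) x).symm y =
      Function.update x a ((extChartAt I (x a)).symm z) := by
    funext b
    change (extChartAt I (x b)).symm (y b) = _
    rcases eq_or_ne b a with rfl | hb
    · rw [hya, Function.update_self]
    · rw [hydef, Function.update_of_ne hb, Function.update_of_ne hb]
      exact extChartAt_to_inv (x b)
  refine Eq.trans ?_ (localField_pow_apply Z hy a).symm
  rw [hya]
  exact congrArg (fun q => (mfderiv I 𝓘(ℝ, E) (extChartAt I (x a)) ((extChartAt I (x a)).symm z)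
    ((Z q : Fin (ℓ + 1) → E) a) : E)) hsymm.symm

theorem range_powModel : Set.range (powModel I ℓ) = Set.univ.pi fun _ => Set.range I :=
  range_modelWithCorners_pi

theorem localField_diagonalProlongation_eventuallyEq [IsManifold I 1 N]
    (Y : ∀ x : N, TangentSpace I x) (x : Fin (ℓ + 1) → N) :
    localField (powModel I ℓ) (diagonalProlongation I ℓ Y) x
      =ᶠ[𝓝[Set.range (powModel I ℓ)] extChartAt (powModel I ℓ) x x]
        Pi.map fun a => localField I Y (x a) := by
  filter_upwards [extChartAt_target_mem_nhdsWithin (I := powModel I ℓ) x] with y hy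
  exact funext (localField_pow_apply _ hy)

theorem mlieBracket_diagonalProlongation [IsManifold I ∞ N]
    {Y Z : ∀ x : N, TangentSpace I x} (hY : IsSmoothVectorField I Y)
    (hZ : IsSmoothVectorField I Z) :
    VectorField.mlieBracket (powModel I ℓ) (diagonalProlongation I ℓ Y)
      (diagonalProlongation I ℓ Z) =
      diagonalProlongation I ℓ (VectorField.mlieBracket I Y Z) := by
  have : IsManifold I 1 N := inferInstance
  funext x
  have hYZ := (localField_diagonalProlongation_eventuallyEq Y
    x).lieBracketWithin_vectorField_eq_of_mem (𝕜 := ℝ)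
    (localField_diagonalProlongation_eventuallyEq Z x) (Set.mem_range_self _)
  have hpi := lieBracketWithin_piMap (y := extChartAt (powModel I ℓ) x x)
    (fun a => I.uniqueDiffOn _ (Set.mem_range_self _))
    (fun a => hY.differentiableWithinAt_localField (x a))
    (fun a => hZ.differentiableWithinAt_localField (x a))
  rw [mlieBracket_eq_lieBracketWithin_localField, hYZ, range_powModel]
  exact hpi.trans (funext fun a => (mlieBracket_eq_lieBracketWithin_localField Y Z (x a)).symm)

theorem mlieBracket_diagonalProlongation_left_apply [IsManifold I ∞ N]
    {Y : ∀ x : N, TangentSpace I x} (hY : IsSmoothVectorField I Y)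
    {Z : ∀ x : Fin (ℓ + 1) → N, TangentSpace (powModel I ℓ) x}
    (hZ : IsSmoothVectorField (powModel I ℓ) Z) (x : Fin (ℓ + 1) → N) (a : Fin (ℓ + 1)) :
    (VectorField.mlieBracket (powModel I ℓ) (diagonalProlongation I ℓ Y) Z x :
      Fin (ℓ + 1) → E) a =
      (show E from VectorField.mlieBracket I Y (sliceField Z x a) (x a)) +
        fderivWithin ℝ (localField (powModel I ℓ) Z x) (Set.range (powModel I ℓ))
          (extChartAt (powModel I ℓ) x x)
          (Function.update (diagonalProlongation I ℓ Y x : Fin (ℓ + 1) → E) a 0) a := by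
  have : IsManifold I 1 N := inferInstance
  have hY' (b : Fin (ℓ + 1)) := hY.differentiableWithinAt_localField (x b)
  have hZ' := hZ.differentiableWithinAt_localField x
  have hYself : Pi.map (fun b => localField I Y (x b)) (extChartAt (powModel I ℓ) x x) =
      diagonalProlongation I ℓ Y x := funext fun b => localField_extChartAt_self Y (x b)
  have hslice : localField I (sliceField Z x a) (x a)
      =ᶠ[𝓝[Set.range I] extChartAt I (x a) (x a)] fun z => localField (powModel I ℓ) Z x
        (Function.update (extChartAt (powModel I ℓ) x x) a z) a := by
    filter_upwards [extChartAt_target_mem_nhdsWithin (I := I) (x a)] with z hz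
    exact localField_sliceField Z x hz
  have hbracket := Filter.EventuallyEq.rfl.lieBracketWithin_vectorField_eq_of_mem (𝕜 := ℝ)
    (V := localField I Y (x a)) hslice (Set.mem_range_self _)
  rw [mlieBracket_eq_lieBracketWithin_localField, mlieBracket_eq_lieBracketWithin_localField,
    (localField_diagonalProlongation_eventuallyEq Y x).lieBracketWithin_vectorField_eq_of_mem
      Filter.EventuallyEq.rfl (Set.mem_range_self _), hbracket, ← hYself]
  simp only [range_powModel] at hZ' ⊢
  exact lieBracketWithin_piMap_left_apply (fun b _ => Set.mem_range_self _)
    (fun b => I.uniqueDiffOn _ (Set.mem_range_self _)) hY' hZ' a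

end ProlongedField

/-! ### Prolongation of one-forms -/

section ProlongedForm

theorem sum_blockInclusion_apply {ℓ k : ℕ} (f : Fin (ℓ + 1) → Fin k → ℝ) (a : Fin (ℓ + 1))
    (β : Fin k) : (∑ b, blockInclusion ℓ k b (f b)) (finProdFinEquiv (a, β)) = f a β := by
  simp only [blockInclusion, sum_apply, ContinuousLinearMap.smulRight_apply,
    ContinuousLinearMap.proj_apply, Finset.sum_apply, Pi.smul_apply, Pi.single_apply,
    EmbeddingLike.apply_eq_iff_eq, Prod.mk.injEq, smul_eq_mul, mul_ite, mul_one, mul_zero]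
  rw [Finset.sum_eq_single a, Finset.sum_eq_single β] <;> simp +contextual [eq_comm]

theorem sum_blockInclusion_eq_zero_iff {ℓ k : ℕ} {f : Fin (ℓ + 1) → Fin k → ℝ} :
    ∑ b, blockInclusion ℓ k b (f b) = 0 ↔ ∀ a, f a = 0 := by
  refine ⟨fun h a => funext fun β => ?_, fun h => by simp [h]⟩
  rw [← sum_blockInclusion_apply f a β, h]
  rfl

variable {E : Type*} [NormedAddCommGroup E] [NormedSpace ℝ E] {H : Type*} [TopologicalSpace H]
  {I : ModelWithCorners ℝ E H} {N : Type*} [TopologicalSpace N] [ChartedSpace H N] {ℓ k : ℕ}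
  {η : ∀ x : N, TangentSpace I x →L[ℝ] (Fin k → ℝ)}

theorem prolongedForm_apply (x : Fin (ℓ + 1) → N) (v : Fin (ℓ + 1) → E) :
    prolongedForm I ℓ η x v = ∑ a, blockInclusion ℓ k a (η (x a) (v a)) := by
  refine (sum_apply Finset.univ _ _).trans (Finset.sum_congr rfl fun a _ => ?_)
  rw [(hasMFDerivAt_proj (I := fun _ : Fin (ℓ + 1) => I) a x).mfderiv]
  rfl

theorem prolongedForm_apply_eq_zero_iff {x : Fin (ℓ + 1) → N} {v : Fin (ℓ + 1) → E} :
    prolongedForm I ℓ η x v = 0 ↔ ∀ a, η (x a) (v a) = 0 := by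
  rw [prolongedForm_apply, sum_blockInclusion_eq_zero_iff]

variable (E ℓ k) in
/-- The pull-back of an `ℝ^k`-valued linear form along the `a`-th projection `E^{ℓ+1} → E`, as the
`a`-th block of an `ℝ^{k(ℓ+1)}`-valued one. It is the local expression of `η ↦ pr_a^* η`, and is
bundled as a continuous linear map in the form so that it can be differentiated. -/
def blockPullback (a : Fin (ℓ + 1)) :
    (E →L[ℝ] (Fin k → ℝ)) →L[ℝ] ((Fin (ℓ + 1) → E) →L[ℝ] (Fin ((ℓ + 1) * k) → ℝ)) :=
  ((ContinuousLinearMap.compL ℝ (Fin (ℓ + 1) → E) (Fin k → ℝ) (Fin ((ℓ + 1) * k) → ℝ))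
    (blockInclusion ℓ k a)).comp (((ContinuousLinearMap.compL ℝ (Fin (ℓ + 1) → E) E
      (Fin k → ℝ)).flip (ContinuousLinearMap.proj (R := ℝ) (φ := fun _ : Fin (ℓ + 1) => E) a)))

theorem localForm_prolongedForm [IsManifold I 1 N] {x : Fin (ℓ + 1) → N}
    {y : Fin (ℓ + 1) → E} (hy : y ∈ (extChartAt (powModel I ℓ) x).target) :
    localForm (powModel I ℓ) (prolongedForm I ℓ η) x y =
      ∑ a, blockPullback E ℓ k a (localForm I η (x a) (y a)) := by
  ext1 v
  rw [sum_apply]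
  refine (prolongedForm_apply _ _).trans (Finset.sum_congr rfl fun a _ => ?_)
  rw [mfderivWithin_extChartAt_symm_pi (I := fun _ => I) hy]
  rfl

theorem localForm_prolongedForm_eventuallyEq [IsManifold I 1 N] (x : Fin (ℓ + 1) → N) :
    localForm (powModel I ℓ) (prolongedForm I ℓ η) x
      =ᶠ[𝓝[Set.range (powModel I ℓ)] extChartAt (powModel I ℓ) x x]
        fun y => ∑ a, blockPullback E ℓ k a (localForm I η (x a) (y a)) := by
  filter_upwards [extChartAt_target_mem_nhdsWithin (I := powModel I ℓ) x] with y hy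
  exact localForm_prolongedForm hy

theorem mapsTo_apply_range_powModel (a : Fin (ℓ + 1)) :
    Set.MapsTo (fun y : Fin (ℓ + 1) → E => y a) (Set.range (powModel I ℓ)) (Set.range I) := by
  rintro _ ⟨y, rfl⟩
  exact ⟨y a, rfl⟩

theorem IsSmoothOneForm.prolongedForm [IsManifold I ∞ N] (hη : IsSmoothOneForm I η) :
    IsSmoothOneForm (powModel I ℓ) (prolongedForm I ℓ η) := by
  have : IsManifold I 1 N := inferInstance
  refine isSmoothOneForm_iff_localForm.2 fun x => ?_
  refine ContDiffWithinAt.congr_of_eventuallyEq (ContDiffWithinAt.sum fun a _ => ?_)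
    (localForm_prolongedForm_eventuallyEq x)
    ((localForm_prolongedForm_eventuallyEq x).self_of_nhdsWithin (Set.mem_range_self _))
  exact (blockPullback E ℓ k a).contDiff.contDiffAt.comp_contDiffWithinAt _
    ((isSmoothOneForm_iff_localForm.1 hη (x a)).comp (extChartAt (powModel I ℓ) x x)
      (contDiff_apply ℝ E a).contDiffWithinAt (mapsTo_apply_range_powModel a))

theorem fderivWithin_localForm_prolongedForm_apply [IsManifold I ∞ N] (hη : IsSmoothOneForm I η)
    (x : Fin (ℓ + 1) → N) (v w : Fin (ℓ + 1) → E) :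
    fderivWithin ℝ (localForm (powModel I ℓ) (KContact.prolongedForm I ℓ η) x)
        (Set.range (powModel I ℓ)) (extChartAt (powModel I ℓ) x x) v w =
      ∑ a, blockInclusion ℓ k a (fderivWithin ℝ (localForm I η (x a)) (Set.range I)
        (extChartAt I (x a) (x a)) (v a) (w a)) := by
  have : IsManifold I 1 N := inferInstance
  have hform (a : Fin (ℓ + 1)) : HasFDerivWithinAt (localForm I η (x a))
      (fderivWithin ℝ (localForm I η (x a)) (Set.range I) (extChartAt I (x a) (x a)))
      (Set.range I) (extChartAt (powModel I ℓ) x x a) :=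
    (hη.differentiableWithinAt_localForm (x a)).hasFDerivWithinAt
  have hblock (a : Fin (ℓ + 1)) : HasFDerivWithinAt
      (fun y : Fin (ℓ + 1) → E => blockPullback E ℓ k a (localForm I η (x a) (y a)))
      ((blockPullback E ℓ k a).comp ((fderivWithin ℝ (localForm I η (x a)) (Set.range I)
        (extChartAt I (x a) (x a))).comp
          (ContinuousLinearMap.proj (R := ℝ) (φ := fun _ : Fin (ℓ + 1) => E) a)))
      (Set.range (powModel I ℓ)) (extChartAt (powModel I ℓ) x x) :=
    (blockPullback E ℓ k a).hasFDerivAt.comp_hasFDerivWithinAt _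
      (HasFDerivWithinAt.comp (f := fun y : Fin (ℓ + 1) → E => y a) _ (hform a)
        (hasFDerivAt_apply a _).hasFDerivWithinAt (mapsTo_apply_range_powModel a))
  have hsum := (HasFDerivWithinAt.fun_sum
    fun a (_ : a ∈ Finset.univ) => hblock a).congr_of_eventuallyEq
    (localForm_prolongedForm_eventuallyEq x)
    ((localForm_prolongedForm_eventuallyEq x).self_of_nhdsWithin (Set.mem_range_self _))
  rw [hsum.fderivWithin ((powModel I ℓ).uniqueDiffOn _ (Set.mem_range_self _))]
  simp only [sum_apply, ContinuousLinearMap.comp_apply]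
  rfl

theorem extDerivOneForm_prolongedForm_apply [IsManifold I ∞ N] (hη : IsSmoothOneForm I η)
    (x : Fin (ℓ + 1) → N) (v w : Fin (ℓ + 1) → E) :
    extDerivOneForm (powModel I ℓ) (KContact.prolongedForm I ℓ η) x ![v, w] =
      ∑ a, blockInclusion ℓ k a (extDerivOneForm I η (x a) ![v a, w a]) := by
  rw [extDerivOneForm_apply hη.prolongedForm]
  simp only [fderivWithin_localForm_prolongedForm_apply hη, ← Finset.sum_sub_distrib, ← map_sub,
    extDerivOneForm_apply hη]

theorem ker_prolongedForm (x : Fin (ℓ + 1) → N) :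
    LinearMap.ker (prolongedForm I ℓ η x :
        TangentSpace (powModel I ℓ) x →ₗ[ℝ] (Fin ((ℓ + 1) * k) → ℝ)) =
      (Submodule.pi Set.univ fun a =>
        LinearMap.ker (η (x a) : TangentSpace I (x a) →ₗ[ℝ] (Fin k → ℝ)) :
          Submodule ℝ (∀ a, TangentSpace I (x a))) := by
  ext v
  exact prolongedForm_apply_eq_zero_iff.trans ⟨fun h a _ => h a, fun h a => h a trivial⟩

theorem kerExtDeriv_prolongedForm [IsManifold I ∞ N] (hη : IsSmoothOneForm I η)
    (x : Fin (ℓ + 1) → N) :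
    kerExtDeriv (powModel I ℓ) (prolongedForm I ℓ η) x =
      (Submodule.pi Set.univ fun a => kerExtDeriv I η (x a) :
        Submodule ℝ (∀ a, TangentSpace I (x a))) := by
  ext v
  refine ⟨fun hv a _ w => ?_, fun hv w => ?_⟩
  · have hsum := (extDerivOneForm_prolongedForm_apply hη x v (Pi.single a w)).symm.trans (hv _)
    have hcomponent := sum_blockInclusion_eq_zero_iff.1 hsum a
    exact Pi.single_eq_same (M := fun _ => E) a w ▸ hcomponent
  · refine (extDerivOneForm_prolongedForm_apply hη x v w).trans ?_
    exact sum_blockInclusion_eq_zero_iff.2 fun a => hv a trivial (w a)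

theorem IsKContactForm.prolongedForm [IsManifold I ∞ N] (hη : IsKContactForm I η) :
    IsKContactForm (powModel I ℓ) (prolongedForm I ℓ η) where
  smooth := hη.smooth.prolongedForm
  ker_ne_bot x hbot := by
    rw [ker_prolongedForm] at hbot
    exact hη.ker_ne_bot (x 0) (eq_bot_of_pi_univ_eq_bot hbot 0)
  corank_ker x := by
    have (a : Fin (ℓ + 1)) :=
      finite_quotient_ker (η (x a) : TangentSpace I (x a) →ₗ[ℝ] (Fin k → ℝ))
    have hsum := finrank_quotient_pi (V := fun a => TangentSpace I (x a)) fun a =>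
      LinearMap.ker (η (x a) : TangentSpace I (x a) →ₗ[ℝ] (Fin k → ℝ))
    rw [ker_prolongedForm]
    exact hsum.trans (by simp [hη.corank_ker])
  rank_kerExtDeriv x := by
    have (a : Fin (ℓ + 1)) := finite_of_ker_inf_eq_bot _ (hη.ker_inf_kerExtDeriv (x a))
    have hsum := finrank_submodule_pi (V := fun a => TangentSpace I (x a)) fun a =>
      kerExtDeriv I η (x a)
    rw [kerExtDeriv_prolongedForm hη.smooth]
    exact hsum.trans (by simp [hη.rank_kerExtDeriv])
  ker_inf_kerExtDeriv x := by
    rw [ker_prolongedForm, kerExtDeriv_prolongedForm hη.smooth]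
    refine (Submodule.eq_bot_iff _).2 fun v hv => funext fun a => ?_
    exact (Submodule.eq_bot_iff _).1 (hη.ker_inf_kerExtDeriv (x a)) _
      ⟨hv.1 a trivial, hv.2 a trivial⟩

end ProlongedForm

/-! ### Prolongation of Hamiltonian vector fields and of Lie systems -/

section ProlongedSystem

variable {E : Type*} [NormedAddCommGroup E] [NormedSpace ℝ E] {H : Type*} [TopologicalSpace H]
  {I : ModelWithCorners ℝ E H} {N : Type*} [TopologicalSpace N] [ChartedSpace H N] {ℓ k : ℕ}
  {η : ∀ x : N, TangentSpace I x →L[ℝ] (Fin k → ℝ)}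

/-- The chart at `x a` has derivative `id` at `x a`, so `Z` and its local expression have the same
`a`-th component wherever the `a`-th coordinate is that of `x`. -/
theorem apply_localField_eq_zero_of_apply_eq [IsManifold I 1 N]
    {Z : ∀ x : Fin (ℓ + 1) → N, TangentSpace (powModel I ℓ) x}
    (hker : ∀ x, prolongedForm I ℓ η x (Z x) = 0) {x : Fin (ℓ + 1) → N} {a : Fin (ℓ + 1)}
    {y : Fin (ℓ + 1) → E} (hy : y ∈ (extChartAt (powModel I ℓ) x).target)
    (hya : y a = extChartAt I (x a) (x a)) :
    η (x a) (localField (powModel I ℓ) Z x y a) = 0 := by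
  have hpoint : (extChartAt I (x a)).symm (y a) = x a := by rw [hya, extChartAt_to_inv]
  have hchart (p : N) (hp : p = x a) (w : E) :
      η (x a) (mfderiv I 𝓘(ℝ, E) (extChartAt I (x a)) p w : E) = η p w := by
    subst hp
    rw [mfderiv_extChartAt_self]
    rfl
  have hzero := prolongedForm_apply_eq_zero_iff.1 (hker ((extChartAt (powModel I ℓ) x).symm y)) a
  exact (congrArg (fun w : E => η (x a) w) (localField_pow_apply Z hy a)).trans
    ((hchart _ hpoint _).trans hzero)

theorem apply_fderivWithin_localField_eq_zero [IsManifold I ∞ N]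
    {Z : ∀ x : Fin (ℓ + 1) → N, TangentSpace (powModel I ℓ) x}
    (hZ : IsSmoothVectorField (powModel I ℓ) Z) (hker : ∀ x, prolongedForm I ℓ η x (Z x) = 0)
    (x : Fin (ℓ + 1) → N) {a : Fin (ℓ + 1)} {u : Fin (ℓ + 1) → E} (hu : u a = 0) :
    η (x a) (fderivWithin ℝ (localField (powModel I ℓ) Z x) (Set.range (powModel I ℓ))
      (extChartAt (powModel I ℓ) x x) u a) = 0 := by
  have : IsManifold I 1 N := inferInstance
  let ηa : (Fin (ℓ + 1) → E) →L[ℝ] (Fin k → ℝ) :=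
    (show E →L[ℝ] (Fin k → ℝ) from η (x a)).comp
      (ContinuousLinearMap.proj (R := ℝ) (φ := fun _ : Fin (ℓ + 1) => E) a)
  have hderiv := ηa.hasFDerivAt.comp_hasFDerivWithinAt _
    (hZ.differentiableWithinAt_localField x).hasFDerivWithinAt
  have hzero : ∀ᶠ y in 𝓝[Set.range (powModel I ℓ)] extChartAt (powModel I ℓ) x x,
      y a = extChartAt I (x a) (x a) → ηa (localField (powModel I ℓ) Z x y) = 0 := by
    filter_upwards [extChartAt_target_mem_nhdsWithin (I := powModel I ℓ) x] with y hy hya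
    exact apply_localField_eq_zero_of_apply_eq hker hy hya
  rw [range_powModel] at hderiv hzero ⊢
  exact hasFDerivWithinAt_apply_eq_zero_of_slice (fun b _ => Set.mem_range_self _)
    (fun b => I.uniqueDiffOn _ (Set.mem_range_self _)) hderiv hzero hu

theorem apply_sliceField_eq_zero {Z : ∀ x : Fin (ℓ + 1) → N, TangentSpace (powModel I ℓ) x}
    (hker : ∀ x, prolongedForm I ℓ η x (Z x) = 0) (x : Fin (ℓ + 1) → N) (a : Fin (ℓ + 1)) (p : N) :
    η p (sliceField Z x a p) = 0 := by
  have hpt := prolongedForm_apply_eq_zero_iff.1 (hker (Function.update x a p)) a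
  exact (congrArg (fun q => η q (sliceField Z x a p : E))
    (Function.update_self a p x)).symm.trans hpt

theorem IsHamiltonianVectorField.diagonalProlongation [IsManifold I ∞ N]
    {Y : ∀ x : N, TangentSpace I x} (hY : IsHamiltonianVectorField I η Y) :
    IsHamiltonianVectorField (powModel I ℓ) (prolongedForm I ℓ η)
      (diagonalProlongation I ℓ Y) := by
  refine ⟨hY.1.diagonalProlongation, fun Z hZ hker x =>
    prolongedForm_apply_eq_zero_iff.2 fun a => ?_⟩
  have hslice := hY.2 (sliceField Z x a) (hZ.sliceField x a) (apply_sliceField_eq_zero hker x a)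
    (x a)
  have htransversal := apply_fderivWithin_localField_eq_zero hZ hker x
    (Function.update_self (β := fun _ => E) a 0
      (KContact.diagonalProlongation I ℓ Y x : Fin (ℓ + 1) → E))
  rw [mlieBracket_diagonalProlongation_left_apply hY.1 hZ]
  exact (map_add (η (x a)) _ _).trans (by rw [hslice, htransversal, add_zero])

theorem hamiltonianFunction_diagonalProlongation (Y : ∀ x : N, TangentSpace I x) :
    hamiltonianFunction (powModel I ℓ) (prolongedForm I ℓ η) (diagonalProlongation I ℓ Y) =
      prolongedFunction ℓ (hamiltonianFunction I η Y) := by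
  funext x
  simp only [hamiltonianFunction, prolongedFunction, map_neg, Finset.sum_neg_distrib]
  exact congrArg Neg.neg (prolongedForm_apply x _)

variable (I N ℓ) in
/-- Diagonal prolongation as a linear map, so that Lie algebras of vector fields can be mapped
along it. -/
def diagonalProlongationₗ : (∀ x : N, TangentSpace I x) →ₗ[ℝ]
    (∀ x : Fin (ℓ + 1) → N, TangentSpace (powModel I ℓ) x) where
  toFun := diagonalProlongation I ℓ
  map_add' _ _ := rfl
  map_smul' _ _ := rfl

variable [IsManifold I ∞ N]

theorem IsLieAlgebraOfVectorFields.map_diagonalProlongation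
    {V : Submodule ℝ (∀ x : N, TangentSpace I x)} (hV : IsLieAlgebraOfVectorFields I V) :
    IsLieAlgebraOfVectorFields (powModel I ℓ) (V.map (diagonalProlongationₗ I N ℓ)) := by
  constructor
  · rintro _ ⟨Y, hY, rfl⟩
    exact (hV.1 Y hY).diagonalProlongation
  · rintro _ ⟨Y, hY, rfl⟩ _ ⟨Z, hZ, rfl⟩
    exact ⟨_, hV.2 Y hY Z hZ, (mlieBracket_diagonalProlongation (hV.1 Y hY) (hV.1 Z hZ)).symm⟩

variable {X : ℝ → ∀ x : N, TangentSpace I x}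

theorem IsLieSystem.isLieAlgebra_smallestLieAlgebra (hX : IsLieSystem I X) :
    IsLieAlgebraOfVectorFields I (smallestLieAlgebra I X) := by
  obtain ⟨V, hV, -, hXV⟩ := hX
  refine ⟨fun Y hY => hV.1 Y (Submodule.mem_sInf.1 hY V ⟨hV, hXV⟩), fun Y hY Z hZ => ?_⟩
  refine Submodule.mem_sInf.2 fun W hW => ?_
  exact hW.1.2 Y (Submodule.mem_sInf.1 hY W hW) Z (Submodule.mem_sInf.1 hZ W hW)

theorem IsLieSystem.diagonalProlongation (hX : IsLieSystem I X) :
    IsLieSystem (powModel I ℓ) (fun t => diagonalProlongation I ℓ (X t)) := by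
  obtain ⟨V, hV, hfin, hXV⟩ := hX
  exact ⟨V.map (diagonalProlongationₗ I N ℓ), hV.map_diagonalProlongation,
    inferInstance, fun t => ⟨X t, hXV t, rfl⟩⟩

theorem IsLieSystem.smallestLieAlgebra_diagonalProlongation_le (hX : IsLieSystem I X) :
    smallestLieAlgebra (powModel I ℓ) (fun t => KContact.diagonalProlongation I ℓ (X t)) ≤
      (smallestLieAlgebra I X).map (diagonalProlongationₗ I N ℓ) :=
  sInf_le ⟨hX.isLieAlgebra_smallestLieAlgebra.map_diagonalProlongation, fun t =>
    ⟨X t, Submodule.mem_sInf.2 fun _ hW => hW.2 t, rfl⟩⟩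

theorem IsKContactLieSystem.diagonalProlongation (hX : IsKContactLieSystem I η X) :
    IsKContactLieSystem (powModel I ℓ) (prolongedForm I ℓ η)
      (fun t => diagonalProlongation I ℓ (X t)) where
  isKContactForm := hX.isKContactForm.prolongedForm
  isLieSystem := hX.isLieSystem.diagonalProlongation
  isHamiltonian Z hZ := by
    obtain ⟨Y, hY, rfl⟩ := hX.isLieSystem.smallestLieAlgebra_diagonalProlongation_le hZ
    exact (hX.isHamiltonian Y hY).diagonalProlongation

theorem contMDiff_timeDependent_diagonalProlongation
    (hX : ContMDiff (𝓘(ℝ, ℝ).prod I) I.tangent ∞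
      (fun p : ℝ × N => (⟨p.2, X p.1 p.2⟩ : TangentBundle I N))) :
    ContMDiff (𝓘(ℝ, ℝ).prod (powModel I ℓ)) (powModel I ℓ).tangent ∞
      (fun p : ℝ × (Fin (ℓ + 1) → N) =>
        (⟨p.2, KContact.diagonalProlongation I ℓ (X p.1) p.2⟩ :
          TangentBundle (powModel I ℓ) (Fin (ℓ + 1) → N))) := by
  have : IsManifold I 1 N := inferInstance
  refine fun p => contMDiffAt_tangentBundle_pi.2 fun a => ?_
  have hproj : ContMDiff (𝓘(ℝ, ℝ).prod (powModel I ℓ)) (𝓘(ℝ, ℝ).prod I) ∞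
      (fun p : ℝ × (Fin (ℓ + 1) → N) => (p.1, p.2 a)) :=
    contMDiff_fst.prodMk ((contMDiff_proj (I := fun _ : Fin (ℓ + 1) => I) a).comp contMDiff_snd)
  exact hX.comp hproj p

end ProlongedSystem

end KContact

end

theorem mainTheorem1_general
    {E : Type*} [NormedAddCommGroup E] [NormedSpace ℝ E]
    {H : Type*} [TopologicalSpace H] (I : ModelWithCorners ℝ E H)
    {N : Type*} [TopologicalSpace N] [ChartedSpace H N] [IsManifold I ∞ N]
    {k : ℕ} (η : ∀ x : N, TangentSpace I x →L[ℝ] (Fin k → ℝ))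
    (X : ℝ → ∀ x : N, TangentSpace I x)
    (hX : KContact.IsKContactLieSystem I η X) (ℓ : ℕ) :
    KContact.IsKContactForm (KContact.powModel I ℓ) (KContact.prolongedForm I ℓ η) ∧
    (∀ Y : (∀ x : N, TangentSpace I x), KContact.IsHamiltonianVectorField I η Y →
      KContact.IsHamiltonianVectorField (KContact.powModel I ℓ) (KContact.prolongedForm I ℓ η)
        (KContact.diagonalProlongation I ℓ Y) ∧
      KContact.hamiltonianFunction (KContact.powModel I ℓ) (KContact.prolongedForm I ℓ η)
          (KContact.diagonalProlongation I ℓ Y) =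
        KContact.prolongedFunction ℓ (KContact.hamiltonianFunction I η Y)) ∧
    KContact.IsKContactLieSystem (KContact.powModel I ℓ) (KContact.prolongedForm I ℓ η)
      (fun t => KContact.diagonalProlongation I ℓ (X t)) ∧
    (ContMDiff (𝓘(ℝ, ℝ).prod I) I.tangent ∞
        (fun p : ℝ × N => (⟨p.2, X p.1 p.2⟩ : TangentBundle I N)) →
      ContMDiff (𝓘(ℝ, ℝ).prod (KContact.powModel I ℓ)) (KContact.powModel I ℓ).tangent ∞
        (fun p : ℝ × (Fin (ℓ + 1) → N) =>
          (⟨p.2, KContact.diagonalProlongation I ℓ (X p.1) p.2⟩ :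
            TangentBundle (KContact.powModel I ℓ) (Fin (ℓ + 1) → N)))) :=
  ⟨hX.isKContactForm.prolongedForm,
    fun Y hY => ⟨hY.diagonalProlongation, KContact.hamiltonianFunction_diagonalProlongation Y⟩,
    hX.diagonalProlongation, KContact.contMDiff_timeDependent_diagonalProlongation⟩

theorem mainTheorem1
    {E : Type*} [NormedAddCommGroup E] [NormedSpace ℝ E] [FiniteDimensional ℝ E]
    {H : Type*} [TopologicalSpace H] (I : ModelWithCorners ℝ E H) [I.Boundaryless]
    {N : Type*} [TopologicalSpace N] [T2Space N] [ChartedSpace H N] [IsManifold I ∞ N]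
    {k : ℕ} (η : ∀ x : N, TangentSpace I x →L[ℝ] (Fin k → ℝ))
    (X : ℝ → ∀ x : N, TangentSpace I x)
    (hX : KContact.IsKContactLieSystem I η X) (ℓ : ℕ) :
    KContact.IsKContactForm (KContact.powModel I ℓ) (KContact.prolongedForm I ℓ η) ∧
    (∀ Y : (∀ x : N, TangentSpace I x), KContact.IsHamiltonianVectorField I η Y →
      KContact.IsHamiltonianVectorField (KContact.powModel I ℓ) (KContact.prolongedForm I ℓ η)
        (KContact.diagonalProlongation I ℓ Y) ∧
      KContact.hamiltonianFunction (KContact.powModel I ℓ) (KContact.prolongedForm I ℓ η)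
          (KContact.diagonalProlongation I ℓ Y) =
        KContact.prolongedFunction ℓ (KContact.hamiltonianFunction I η Y)) ∧
    KContact.IsKContactLieSystem (KContact.powModel I ℓ) (KContact.prolongedForm I ℓ η)
      (fun t => KContact.diagonalProlongation I ℓ (X t)) ∧
    (ContMDiff (𝓘(ℝ, ℝ).prod I) I.tangent ∞
        (fun p : ℝ × N => (⟨p.2, X p.1 p.2⟩ : TangentBundle I N)) →
      ContMDiff (𝓘(ℝ, ℝ).prod (KContact.powModel I ℓ)) (KContact.powModel I ℓ).tangent ∞
        (fun p : ℝ × (Fin (ℓ + 1) → N) =>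
          (⟨p.2, KContact.diagonalProlongation I ℓ (X p.1) p.2⟩ :
            TangentBundle (KContact.powModel I ℓ) (Fin (ℓ + 1) → N)))) :=
  mainTheorem1_general I η X hX ℓ
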